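/- **Exact time-evolution operator of two qubits in separate spin-star baths.** Let $N\ge1$, $\delta,\alpha\in\mathbb R$. Let $S^1,S^2$ be the spin operators of two central spins-$\frac12$, and let $J_\pm=\sum_{k=1}^N S^{1k}_\pm$, $\mathcal J_\pm=\sum_{k=1}^N S^{2k}_\pm$ be the total raising and lowering operators of two baths $B_1,B_2$, each consisting of $N$ spins-$\frac12$ (so that $J_\pm$ and $\mathcal J_\pm$ act on $B_1\otimes B_2$, with $B_1=B_2=(\mathbb C^2)^{\otimes N}$). On $\mathbb C^2\otimes\mathbb C^2\otimes B_1\otimes B_2$ put $$H=4\delta S^1_zS^2_z+\frac{\alpha}{\sqrt N}\left(S^1_+J_-+S^1_-J_++S^2_+\mathcal J_-+S^2_-\mathcal J_+\right).$$ For an operator $T$ let $T_{ij}=\langle\chi_i|T|\chi_j\rangle$ ($1\le i,j\le4$) be its operator-valued entries, acting on $B_1\otimes B_2$, with respect to the ordered basis $\chi_1=|{-}{-}\rangle,\chi_2=|{-}{+}\rangle,\chi_3=|{+}{-}\rangle,\chi_4=|{+}{+}\rangle$ of the central spins. Define $$\mathcal M_1^\pm=\delta^2+\tfrac{\alpha^2}N\left(\sqrt{J_+J_-}\pm\sqrt{\mathcal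 J_+\mathcal J_-}\right)^2,\quad \mathcal M_2^\pm=\delta^2+\tfrac{\alpha^2}N\left(\sqrt{J_+J_-}\pm\sqrt{\mathcal J_-\mathcal J_+}\right)^2,$$ $$\mathcal M_3^\pm=\delta^2+\tfrac{\alpha^2}N\left(\sqrt{J_-J_+}\pm\sqrt{\mathcal J_+\mathcal J_-}\right)^2,\quad \mathcal M_4^\pm=\delta^2+\tfrac{\alpha^2}N\left(\sqrt{J_-J_+}\pm\sqrt{\mathcal J_-\mathcal J_+}\right)^2.$$ Functions of positive semidefinite operators are taken in the functional calculus; $1/\sqrt X$ is extended by $0$ to $\ker X$, and $\sin(t\sqrt X)/\sqrt X$ acts as multiplication by $t$ on $\ker X$. Write $\mathrm c_j^\pm=\cos(t\sqrt{\mathcal M_j^\pm})$ and $\mathrm s_j^\pm=\sin(t\sqrt{\mathcal M_j^\pm})/\sqrt{\mathcal M_j^\pm}$. Then: (1) For every integer $n\ge0$ the entries of $H^{2n}$ are as follows, and the entries not listed vanish: - $(H^{2n})_{11}=\tfrac12 [(\mathcal M_1^+)^n+(\mathcal M_1^-)^n]$ - $(H^{2n})_{14}=\tfrac12 J_+\mathcal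 J_+\frac{1}{\sqrt{J_-J_+\mathcal J_-\mathcal J_+}}[(\mathcal M_4^+)^n-(\mathcal M_4^-)^n]$ - $(H^{2n})_{22}=\tfrac12 [(\mathcal M_2^+)^n+(\mathcal M_2^-)^n]$ - $(H^{2n})_{23}=\tfrac12 J_+\mathcal J_-\frac{1}{\sqrt{J_-J_+\mathcal J_+\mathcal J_-}}[(\mathcal M_3^+)^n-(\mathcal M_3^-)^n]$ - $(H^{2n})_{32}=\tfrac12 J_-\mathcal J_+\frac{1}{\sqrt{J_+J_-\mathcal J_-\mathcal J_+}}[(\mathcal M_2^+)^n-(\mathcal M_2^-)^n]$ - $(H^{2n})_{33}=\tfrac12 [(\mathcal M_3^+)^n+(\mathcal M_3^-)^n]$ - $(H^{2n})_{41}=\tfrac12 J_-\mathcal J_-\frac{1}{\sqrt{J_+J_-\mathcal J_+\mathcal J_-}}[(\mathcal M_1^+)^n-(\mathcal M_1^-)^n]$ - $(H^{2n})_{44}=\tfrac12 [(\mathcal M_4^+)^n+(\mathcal M_4^-)^n]$ (2) For every integer $n\ge0$: - $(H^{2n+1})_{11}=\tfrac\delta2 [(\mathcal M_1^+)^n+(\mathcal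 M_1^-)^n]$ - $(H^{2n+1})_{12}=\tfrac\alpha2\mathcal J_+\frac{1}{\sqrt{N\mathcal J_-\mathcal J_+}}[(\sqrt{\mathcal J_-\mathcal J_+}+\sqrt{J_+J_-})(\mathcal M_2^+)^n+(\sqrt{\mathcal J_-\mathcal J_+}-\sqrt{J_+J_-})(\mathcal M_2^-)^n]$ - $(H^{2n+1})_{13}=\tfrac\alpha2J_+\frac{1}{\sqrt{NJ_-J_+}}[(\sqrt{J_-J_+}+\sqrt{\mathcal J_+\mathcal J_-})(\mathcal M_3^+)^n+(\sqrt{J_-J_+}-\sqrt{\mathcal J_+\mathcal J_-})(\mathcal M_3^-)^n]$ - $(H^{2n+1})_{14}=\tfrac\delta2 J_+\mathcal J_+\frac{1}{\sqrt{J_-J_+\mathcal J_-\mathcal J_+}}[(\mathcal M_4^+)^n-(\mathcal M_4^-)^n]$ - $(H^{2n+1})_{21}=\tfrac\alpha2\mathcal J_-\frac{1}{\sqrt{N\mathcal J_+\mathcal J_-}}[(\sqrt{\mathcal J_+\mathcal J_-}+\sqrt{J_+J_-})(\mathcal M_1^+)^n+(\sqrt{\mathcal J_+\mathcal J_-}-\sqrt{J_+J_-})(\mathcal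 M_1^-)^n]$ - $(H^{2n+1})_{22}=-\tfrac\delta2 [(\mathcal M_2^+)^n+(\mathcal M_2^-)^n]$ - $(H^{2n+1})_{23}=-\tfrac\delta2 J_+\mathcal J_-\frac{1}{\sqrt{J_-J_+\mathcal J_+\mathcal J_-}}[(\mathcal M_3^+)^n-(\mathcal M_3^-)^n]$ - $(H^{2n+1})_{24}=\tfrac\alpha2J_+\frac{1}{\sqrt{NJ_-J_+}}[(\sqrt{J_-J_+}+\sqrt{\mathcal J_-\mathcal J_+})(\mathcal M_4^+)^n+(\sqrt{J_-J_+}-\sqrt{\mathcal J_-\mathcal J_+})(\mathcal M_4^-)^n]$ - $(H^{2n+1})_{31}=\tfrac\alpha2J_-\frac{1}{\sqrt{NJ_+J_-}}[(\sqrt{J_+J_-}+\sqrt{\mathcal J_+\mathcal J_-})(\mathcal M_1^+)^n+(\sqrt{J_+J_-}-\sqrt{\mathcal J_+\mathcal J_-})(\mathcal M_1^-)^n]$ - $(H^{2n+1})_{32}=-\tfrac\delta2 J_-\mathcal J_+\frac{1}{\sqrt{J_+J_-\mathcal J_-\mathcal J_+}}[(\mathcal M_2^+)^n-(\mathcal M_2^-)^n]$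 - $(H^{2n+1})_{33}=-\tfrac\delta2 [(\mathcal M_3^+)^n+(\mathcal M_3^-)^n]$ - $(H^{2n+1})_{34}=\tfrac\alpha2\mathcal J_+\frac{1}{\sqrt{N\mathcal J_-\mathcal J_+}}[(\sqrt{\mathcal J_-\mathcal J_+}+\sqrt{J_-J_+})(\mathcal M_4^+)^n+(\sqrt{\mathcal J_-\mathcal J_+}-\sqrt{J_-J_+})(\mathcal M_4^-)^n]$ - $(H^{2n+1})_{41}=\tfrac\delta2 J_-\mathcal J_-\frac{1}{\sqrt{J_+J_-\mathcal J_+\mathcal J_-}}[(\mathcal M_1^+)^n-(\mathcal M_1^-)^n]$ - $(H^{2n+1})_{42}=\tfrac\alpha2J_-\frac{1}{\sqrt{NJ_+J_-}}[(\sqrt{J_+J_-}+\sqrt{\mathcal J_-\mathcal J_+})(\mathcal M_2^+)^n+(\sqrt{J_+J_-}-\sqrt{\mathcal J_-\mathcal J_+})(\mathcal M_2^-)^n]$ - $(H^{2n+1})_{43}=\tfrac\alpha2\mathcal J_-\frac{1}{\sqrt{N\mathcal J_+\mathcal J_-}}[(\sqrt{\mathcal J_+\mathcal J_-}+\sqrt{J_-J_+})(\mathcal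 M_3^+)^n+(\sqrt{\mathcal J_+\mathcal J_-}-\sqrt{J_-J_+})(\mathcal M_3^-)^n]$ - $(H^{2n+1})_{44}=\tfrac\delta2 [(\mathcal M_4^+)^n+(\mathcal M_4^-)^n]$ (3) For every $t\in\mathbb R$ the entries $U_{ij}=U_{ij}(t)$ of $U(t)=\exp(-iHt)$ are: - $U_{11}=\tfrac12 \{\mathrm{c}_1^++\mathrm{c}_1^--i\delta[\mathrm{s}_1^++\mathrm{s}_1^-]\}$ - $U_{12}=-\tfrac{i\alpha}2\mathcal J_+\frac{1}{\sqrt{N\mathcal J_-\mathcal J_+}}[(\sqrt{\mathcal J_-\mathcal J_+}+\sqrt{J_+J_-})\mathrm{s}_2^++(\sqrt{\mathcal J_-\mathcal J_+}-\sqrt{J_+J_-})\mathrm{s}_2^-]$ - $U_{13}=-\tfrac{i\alpha}2J_+\frac{1}{\sqrt{NJ_-J_+}}[(\sqrt{J_-J_+}+\sqrt{\mathcal J_+\mathcal J_-})\mathrm{s}_3^++(\sqrt{J_-J_+}-\sqrt{\mathcal J_+\mathcal J_-})\mathrm{s}_3^-]$ - $U_{14}=\tfrac12 J_+\mathcal J_+\frac{1}{\sqrt{J_-J_+\mathcal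 J_-\mathcal J_+}}\{\mathrm{c}_4^+-\mathrm{c}_4^--i\delta[\mathrm{s}_4^+-\mathrm{s}_4^-]\}$ - $U_{21}=-\tfrac{i\alpha}2\mathcal J_-\frac{1}{\sqrt{N\mathcal J_+\mathcal J_-}}[(\sqrt{\mathcal J_+\mathcal J_-}+\sqrt{J_+J_-})\mathrm{s}_1^++(\sqrt{\mathcal J_+\mathcal J_-}-\sqrt{J_+J_-})\mathrm{s}_1^-]$ - $U_{22}=\tfrac12 \{\mathrm{c}_2^++\mathrm{c}_2^-+i\delta[\mathrm{s}_2^++\mathrm{s}_2^-]\}$ - $U_{23}=\tfrac12 J_+\mathcal J_-\frac{1}{\sqrt{J_-J_+\mathcal J_+\mathcal J_-}}\{\mathrm{c}_3^+-\mathrm{c}_3^-+i\delta[\mathrm{s}_3^+-\mathrm{s}_3^-]\}$ - $U_{24}=-\tfrac{i\alpha}2J_+\frac{1}{\sqrt{NJ_-J_+}}[(\sqrt{J_-J_+}+\sqrt{\mathcal J_-\mathcal J_+})\mathrm{s}_4^++(\sqrt{J_-J_+}-\sqrt{\mathcal J_-\mathcal J_+})\mathrm{s}_4^-]$ - $U_{31}=-\tfrac{i\alpha}2J_-\frac{1}{\sqrt{NJ_+J_-}}[(\sqrt{J_+J_-}+\sqrt{\mathcal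 J_+\mathcal J_-})\mathrm{s}_1^++(\sqrt{J_+J_-}-\sqrt{\mathcal J_+\mathcal J_-})\mathrm{s}_1^-]$ - $U_{32}=\tfrac12 J_-\mathcal J_+\frac{1}{\sqrt{J_+J_-\mathcal J_-\mathcal J_+}}\{\mathrm{c}_2^+-\mathrm{c}_2^-+i\delta[\mathrm{s}_2^+-\mathrm{s}_2^-]\}$ - $U_{33}=\tfrac12 \{\mathrm{c}_3^++\mathrm{c}_3^-+i\delta[\mathrm{s}_3^++\mathrm{s}_3^-]\}$ - $U_{34}=-\tfrac{i\alpha}2\mathcal J_+\frac{1}{\sqrt{N\mathcal J_-\mathcal J_+}}[(\sqrt{\mathcal J_-\mathcal J_+}+\sqrt{J_-J_+})\mathrm{s}_4^++(\sqrt{\mathcal J_-\mathcal J_+}-\sqrt{J_-J_+})\mathrm{s}_4^-]$ - $U_{41}=\tfrac12 J_-\mathcal J_-\frac{1}{\sqrt{J_+J_-\mathcal J_+\mathcal J_-}}\{\mathrm{c}_1^+-\mathrm{c}_1^--i\delta[\mathrm{s}_1^+-\mathrm{s}_1^-]\}$ - $U_{42}=-\tfrac{i\alpha}2J_-\frac{1}{\sqrt{NJ_+J_-}}[(\sqrt{J_+J_-}+\sqrt{\mathcal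 J_-\mathcal J_+})\mathrm{s}_2^++(\sqrt{J_+J_-}-\sqrt{\mathcal J_-\mathcal J_+})\mathrm{s}_2^-]$ - $U_{43}=-\tfrac{i\alpha}2\mathcal J_-\frac{1}{\sqrt{N\mathcal J_+\mathcal J_-}}[(\sqrt{\mathcal J_+\mathcal J_-}+\sqrt{J_-J_+})\mathrm{s}_3^++(\sqrt{\mathcal J_+\mathcal J_-}-\sqrt{J_-J_+})\mathrm{s}_3^-]$ - $U_{44}=\tfrac12 \{\mathrm{c}_4^++\mathrm{c}_4^--i\delta[\mathrm{s}_4^++\mathrm{s}_4^-]\}$ -/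

import Mathlib

open scoped Matrix Kronecker

noncomputable section

namespace SpinStar

/-! Single spin-1/2 operators. Index `0` is the basis vector `|-⟩`, index `1` is `|+⟩`. -/

/-- `S_z = diag(-1/2, 1/2)`. -/
def Sz : Matrix (Fin 2) (Fin 2) ℂ := !![-(1 / 2), 0; 0, 1 / 2]

/-- The raising operator `S_+ = |+⟩⟨-|`. -/
def Sp : Matrix (Fin 2) (Fin 2) ℂ := !![0, 0; 1, 0]

/-- The lowering operator `S_- = |-⟩⟨+|`. -/
def Sm : Matrix (Fin 2) (Fin 2) ℂ := !![0, 1; 0, 0]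

/-- Labels of the product basis of one bath `(ℂ²)^{⊗ N}`. -/
abbrev Bath (N : ℕ) : Type := Fin N → Fin 2

/-- Operators on one bath. -/
abbrev BathOp (N : ℕ) : Type := Matrix (Bath N) (Bath N) ℂ

/-- Operators on the two baths `B₁ ⊗ B₂`. -/
abbrev EnvOp (N : ℕ) : Type := Matrix (Bath N × Bath N) (Bath N × Bath N) ℂ

/-- Operators on the whole system `(ℂ² ⊗ ℂ²) ⊗ (B₁ ⊗ B₂)`. -/
abbrev TotalOp (N : ℕ) : Type :=
  Matrix ((Fin 2 × Fin 2) × (Bath N × Bath N)) ((Fin 2 × Fin 2) × (Bath N × Bath N)) ℂ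

/-- `1 ⊗ ⋯ ⊗ A ⊗ ⋯ ⊗ 1` with `A` acting on the `k`-th spin of a bath. -/
def siteOp {N : ℕ} (k : Fin N) (A : Matrix (Fin 2) (Fin 2) ℂ) : BathOp N :=
  Matrix.of fun σ τ => ∏ l : Fin N, (if l = k then A else 1) (σ l) (τ l)

/-- The sum over all spins of a bath of the single-spin operator `A`. -/
def totalSpin (N : ℕ) (A : Matrix (Fin 2) (Fin 2) ℂ) : BathOp N := ∑ k : Fin N, siteOp k A

/-- `J_+`, acting on `B₁`. -/
def Jp (N : ℕ) : EnvOp N := totalSpin N Sp ⊗ₖ (1 : BathOp N)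

/-- `J_-`, acting on `B₁`. -/
def Jm (N : ℕ) : EnvOp N := totalSpin N Sm ⊗ₖ (1 : BathOp N)

/-- `𝒥_+`, acting on `B₂`. -/
def Kp (N : ℕ) : EnvOp N := (1 : BathOp N) ⊗ₖ totalSpin N Sp

/-- `𝒥_-`, acting on `B₂`. -/
def Km (N : ℕ) : EnvOp N := (1 : BathOp N) ⊗ₖ totalSpin N Sm

/-- The operator `A` acting on the first central qubit. -/
def qubit1 (A : Matrix (Fin 2) (Fin 2) ℂ) : Matrix (Fin 2 × Fin 2) (Fin 2 × Fin 2) ℂ :=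
  A ⊗ₖ (1 : Matrix (Fin 2) (Fin 2) ℂ)

/-- The operator `A` acting on the second central qubit. -/
def qubit2 (A : Matrix (Fin 2) (Fin 2) ℂ) : Matrix (Fin 2 × Fin 2) (Fin 2 × Fin 2) ℂ :=
  (1 : Matrix (Fin 2) (Fin 2) ℂ) ⊗ₖ A

/-- The Hamiltonian
`H = 4 δ S¹_z S²_z + (α / √N) (S¹_+ J_- + S¹_- J_+ + S²_+ 𝒥_- + S²_- 𝒥_+)`. -/
def H (N : ℕ) (δ α : ℝ) : TotalOp N :=
  (4 * δ : ℂ) • ((qubit1 Sz * qubit2 Sz) ⊗ₖ (1 : EnvOp N))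
    + ((α / Real.sqrt N : ℝ) : ℂ) •
      (qubit1 Sp ⊗ₖ Jm N + qubit1 Sm ⊗ₖ Jp N + qubit2 Sp ⊗ₖ Km N + qubit2 Sm ⊗ₖ Kp N)

/-- The ordered basis `|--⟩, |-+⟩, |+-⟩, |++⟩` of `ℂ² ⊗ ℂ²`. -/
def chi : Fin 4 → Fin 2 × Fin 2 := ![(0, 0), (0, 1), (1, 0), (1, 1)]

/-- The operator-valued `4 × 4` matrix `T_{ij} = ⟨χ_i| T |χ_j⟩` of an operator `T` on the whole
system; its entries are operators on `B₁ ⊗ B₂`. -/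
def blocks {N : ℕ} (T : TotalOp N) : Matrix (Fin 4) (Fin 4) (EnvOp N) :=
  Matrix.of fun i j => T.submatrix (fun e => (chi i, e)) (fun e => (chi j, e))

/-! Functions of a Hermitian positive semidefinite operator, by the functional calculus. -/

/-- `√X`. -/
def opSqrt {N : ℕ} (X : EnvOp N) : EnvOp N := cfc (fun x : ℝ => Real.sqrt x) X

/-- `1 / √X`, taken on the orthogonal complement of the kernel of `X` and extended by `0` to the
kernel (the Moore-Penrose inverse of `√X`). -/
def opInvSqrt {N : ℕ} (X : EnvOp N) : EnvOp N :=
  cfc (fun x : ℝ => if x = 0 then 0 else 1 / Real.sqrt x) X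

/-- `cos (t √X)`. -/
def opCos {N : ℕ} (t : ℝ) (X : EnvOp N) : EnvOp N :=
  cfc (fun x : ℝ => Real.cos (t * Real.sqrt x)) X

/-- `sin (t √X) / √X`, where `sin (t √x) / √x` has at `x = 0` its limit value `t`. -/
def opSinDiv {N : ℕ} (t : ℝ) (X : EnvOp N) : EnvOp N :=
  cfc (fun x : ℝ => if x = 0 then t else Real.sin (t * Real.sqrt x) / Real.sqrt x) X

/-- `δ² + (α² / N) (√X + √Y)²`. -/
def Mplus {N : ℕ} (δ α : ℝ) (X Y : EnvOp N) : EnvOp N :=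
  ((δ ^ 2 : ℝ) : ℂ) • (1 : EnvOp N) + ((α ^ 2 / N : ℝ) : ℂ) • (opSqrt X + opSqrt Y) ^ 2

/-- `δ² + (α² / N) (√X - √Y)²`. -/
def Mminus {N : ℕ} (δ α : ℝ) (X Y : EnvOp N) : EnvOp N :=
  ((δ ^ 2 : ℝ) : ℂ) • (1 : EnvOp N) + ((α ^ 2 / N : ℝ) : ℂ) • (opSqrt X - opSqrt Y) ^ 2

/-- `√(J_+ J_-)`. -/
def r₁ (N : ℕ) : EnvOp N := opSqrt (Jp N * Jm N)

/-- `√(J_- J_+)`. -/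
def r₂ (N : ℕ) : EnvOp N := opSqrt (Jm N * Jp N)

/-- `√(𝒥_+ 𝒥_-)`. -/
def s₁ (N : ℕ) : EnvOp N := opSqrt (Kp N * Km N)

/-- `√(𝒥_- 𝒥_+)`. -/
def s₂ (N : ℕ) : EnvOp N := opSqrt (Km N * Kp N)

/-- `𝓜_1^+ = δ² + (α² / N) (√(J_+ J_-) + √(𝒥_+ 𝒥_-))²`. -/
def M1p (N : ℕ) (δ α : ℝ) : EnvOp N := Mplus δ α (Jp N * Jm N) (Kp N * Km N)

/-- `𝓜_1^- = δ² + (α² / N) (√(J_+ J_-) - √(𝒥_+ 𝒥_-))²`. -/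
def M1m (N : ℕ) (δ α : ℝ) : EnvOp N := Mminus δ α (Jp N * Jm N) (Kp N * Km N)

/-- `𝓜_2^+ = δ² + (α² / N) (√(J_+ J_-) + √(𝒥_- 𝒥_+))²`. -/
def M2p (N : ℕ) (δ α : ℝ) : EnvOp N := Mplus δ α (Jp N * Jm N) (Km N * Kp N)

/-- `𝓜_2^- = δ² + (α² / N) (√(J_+ J_-) - √(𝒥_- 𝒥_+))²`. -/
def M2m (N : ℕ) (δ α : ℝ) : EnvOp N := Mminus δ α (Jp N * Jm N) (Km N * Kp N)

/-- `𝓜_3^+ = δ² + (α² / N) (√(J_- J_+) + √(𝒥_+ 𝒥_-))²`. -/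
def M3p (N : ℕ) (δ α : ℝ) : EnvOp N := Mplus δ α (Jm N * Jp N) (Kp N * Km N)

/-- `𝓜_3^- = δ² + (α² / N) (√(J_- J_+) - √(𝒥_+ 𝒥_-))²`. -/
def M3m (N : ℕ) (δ α : ℝ) : EnvOp N := Mminus δ α (Jm N * Jp N) (Kp N * Km N)

/-- `𝓜_4^+ = δ² + (α² / N) (√(J_- J_+) + √(𝒥_- 𝒥_+))²`. -/
def M4p (N : ℕ) (δ α : ℝ) : EnvOp N := Mplus δ α (Jm N * Jp N) (Km N * Kp N)

/-- `𝓜_4^- = δ² + (α² / N) (√(J_- J_+) - √(𝒥_- 𝒥_+))²`. -/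
def M4m (N : ℕ) (δ α : ℝ) : EnvOp N := Mminus δ α (Jm N * Jp N) (Km N * Kp N)

end SpinStar

end

/-!
Write `c = α / √N`. With respect to the basis `χ₁, …, χ₄` the Hamiltonian is a `4 × 4` matrix of bath
operators: `δ, -δ, -δ, δ` on the diagonal, `c` times one of the ladder operators wherever exactly
one central spin is flipped, and `0` elsewhere. The entries of `H^{2n}` and `H^{2n+1}` claimed by the
theorem are fixed linear expressions `E` and `O` in the operators `(𝓜_j^±)^n`. It therefore suffices
to show, for arbitrary operators `x_j^±` in place of these powers, that `H E(x) = O(x)`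
(`blocks_H_mul_evenBlocks`) and `H O(x) = E(𝓜 x)` (`blocks_H_mul_oddBlocks`), and that `E(1) = 1`;
the powers follow by induction.

The `j`-th columns of these two identities involve only `x_j^±`, and all four are instances of one
computation, for a pair of ladder operators `A`, `B` that act on different baths (`LadderPair`):
`A` and `B` accompany the flips of the first and of the second spin, `A'` and `B'` are their adjoints,
and `r = √(A' A)`, `s = √(B' B)`. The computation rests on three facts about the functional calculus.
The generalized inverse `r⁺ = 1 / √(A' A)` satisfies `A' A r⁺ = r`; it satisfies `A r⁺ r = A`, because
`A` vanishes on `ker (A' A)`; and `1 / √(A' A B' B) = r⁺ s⁺`, because `r s` is the square root of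
`A' A B' B` and a commuting generalized inverse is unique (`opInvSqrt_mul_of_commute`).

The time evolution is the sum of the exponential series. Its even and odd parts are `E` and `O`
applied to the series of `cos (t √x)` and `-i sin (t √x) / √x` at `x = 𝓜_j^±`, and `E` and `O` are
linear, hence continuous, so the sums may be taken inside (`blocks_exp_apply`). The operators
`𝓜_j^±` are positive semidefinite, so the two series converge to the functional calculus
(`hasSum_cfc`), also on the kernel of `𝓜_j^±`.
-/

namespace SpinStar

/-! ### Functions of positive semidefinite operators -/

section FunctionalCalculus

open scoped MatrixOrder ComplexOrder

variable {N : ℕ} {X Y : EnvOp N}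

lemma continuousOn_spectrum (X : EnvOp N) (f : ℝ → ℝ) : ContinuousOn f (spectrum ℝ X) :=
  X.finite_real_spectrum.continuousOn f

lemma nonneg_of_mem_spectrum (hX : X.PosSemidef) {x : ℝ} (hx : x ∈ spectrum ℝ X) : 0 ≤ x :=
  spectrum_nonneg_of_nonneg hX.nonneg hx

lemma opSqrt_posSemidef (X : EnvOp N) : (opSqrt X).PosSemidef :=
  Matrix.nonneg_iff_posSemidef.1 (cfc_nonneg fun _ _ => Real.sqrt_nonneg _)

lemma opSqrt_mul_self (hX : X.PosSemidef) : opSqrt X * opSqrt X = X := by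
  rw [opSqrt, ← cfc_mul _ _ X (continuousOn_spectrum _ _) (continuousOn_spectrum _ _)]
  conv_rhs => rw [← cfc_id' ℝ X hX.isHermitian.isSelfAdjoint]
  exact cfc_congr fun x hx => Real.mul_self_sqrt (nonneg_of_mem_spectrum hX hx)

lemma opSqrt_of_sq (hX : X.PosSemidef) : opSqrt (X * X) = X := by
  have h : IsSelfAdjoint X := hX.isHermitian
  rw [opSqrt, ← sq, ← cfc_comp_pow _ 2 X ((X.finite_real_spectrum.image _).continuousOn _) h]
  conv_rhs => rw [← cfc_id' ℝ X h]
  exact cfc_congr fun x hx => Real.sqrt_sq (nonneg_of_mem_spectrum hX hx)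

lemma commute_opSqrt_left (h : Commute X Y) : Commute (opSqrt X) Y := h.cfc_real _

lemma commute_opInvSqrt_left (h : Commute X Y) : Commute (opInvSqrt X) Y := h.cfc_real _

lemma commute_opInvSqrt_opSqrt (X : EnvOp N) : Commute (opInvSqrt X) (opSqrt X) :=
  cfc_commute_cfc _ _ X

lemma mul_opInvSqrt (hX : X.PosSemidef) : X * opInvSqrt X = opSqrt X := by
  nth_rw 1 [← cfc_id' ℝ X hX.isHermitian.isSelfAdjoint]
  rw [opInvSqrt, opSqrt,
    ← cfc_mul _ _ X (continuousOn_spectrum _ _) (continuousOn_spectrum _ _)]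
  refine cfc_congr fun x hx => ?_
  have h0 := nonneg_of_mem_spectrum hX hx
  by_cases h : x = 0
  · simp [h]
  · simp [h, ← div_eq_mul_inv, Real.div_sqrt]

lemma opSqrt_mul_opInvSqrt_mul_opSqrt (hX : X.PosSemidef) :
    opSqrt X * opInvSqrt X * opSqrt X = opSqrt X := by
  rw [mul_assoc, (commute_opInvSqrt_opSqrt X).eq, ← mul_assoc, opSqrt_mul_self hX,
    mul_opInvSqrt hX]

lemma opInvSqrt_mul_opSqrt_mul_opInvSqrt (hX : X.PosSemidef) :
    opInvSqrt X * opSqrt X * opInvSqrt X = opInvSqrt X := by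
  rw [opInvSqrt, opSqrt,
    ← cfc_mul _ _ X (continuousOn_spectrum _ _) (continuousOn_spectrum _ _),
    ← cfc_mul _ _ X (continuousOn_spectrum _ _) (continuousOn_spectrum _ _)]
  refine cfc_congr fun x hx => ?_
  by_cases h : x = 0
  · simp [h]
  · have : Real.sqrt x ≠ 0 :=
      (Real.sqrt_pos.2 (lt_of_le_of_ne (nonneg_of_mem_spectrum hX hx) (Ne.symm h))).ne'
    simp [h, this]

/-- The support projection of `Aᴴ A` acts as the identity to the right of `A`, because `A`
vanishes on the kernel of `Aᴴ A`. -/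
lemma mul_opInvSqrt_mul_opSqrt (A : EnvOp N) :
    A * (opInvSqrt (Aᴴ * A) * opSqrt (Aᴴ * A)) = A := by
  have hX : (Aᴴ * A).PosSemidef := Matrix.posSemidef_conjTranspose_mul_self A
  have h : Aᴴ * A * (opInvSqrt (Aᴴ * A) * opSqrt (Aᴴ * A) - 1) = 0 := by
    rw [mul_sub, ← mul_assoc, mul_opInvSqrt hX, opSqrt_mul_self hX, mul_one, sub_self]
  rw [Matrix.conjTranspose_mul_self_mul_eq_zero, mul_sub, mul_one, sub_eq_zero] at h
  exact h

lemma opInvSqrt_smul (hX : X.PosSemidef) {c : ℝ} (hc : 0 < c) :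
    opInvSqrt (c • X) = (1 / Real.sqrt c) • opInvSqrt X := by
  rw [opInvSqrt, opInvSqrt, ← cfc_comp_smul c _ X
    ((X.finite_real_spectrum.image _).continuousOn _) hX.isHermitian.isSelfAdjoint,
    ← cfc_smul _ _ X (continuousOn_spectrum _ _)]
  refine cfc_congr fun x _ => ?_
  by_cases h : x = 0
  · simp [h]
  · simp [h, hc.ne', Real.sqrt_mul hc.le, mul_comm]

lemma posSemidef_mul_of_commute (hX : X.PosSemidef) (hY : Y.PosSemidef) (h : Commute X Y) :
    (X * Y).PosSemidef := by
  have hc : Commute (opSqrt X) Y := commute_opSqrt_left h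
  have := hY.mul_mul_conjTranspose_same (opSqrt X)
  rwa [(opSqrt_posSemidef X).isHermitian.eq, hc.eq, mul_assoc, opSqrt_mul_self hX,
    ← h.eq] at this

lemma opSqrt_mul_of_commute (hX : X.PosSemidef) (hY : Y.PosSemidef) (h : Commute X Y) :
    opSqrt (X * Y) = opSqrt X * opSqrt Y := by
  have hr : Commute (opSqrt X) (opSqrt Y) :=
    (commute_opSqrt_left (commute_opSqrt_left h).symm).symm
  rw [← opSqrt_of_sq (posSemidef_mul_of_commute (opSqrt_posSemidef X) (opSqrt_posSemidef Y) hr),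
    hr.symm.mul_mul_mul_comm, opSqrt_mul_self hX, opSqrt_mul_self hY]

/-- Uniqueness of the group inverse: an element `t` of a semigroup has at most one generalized
inverse that commutes with it. -/
lemma eq_of_commute_of_generalized_inverse {R : Type*} [Semigroup R] {t z w : R}
    (hzt : Commute z t) (hwt : Commute w t)
    (htz : t * z * t = t) (hz : z * t * z = z) (htw : t * w * t = t) (hw : w * t * w = w) :
    z = w := by
  have h : z * t = w * t := by
    calc z * t = z * (t * w * t) := by rw [htw]
      _ = t * z * t * w := by rw [mul_assoc t w t, hwt.eq, ← mul_assoc, ← mul_assoc, hzt.eq]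
      _ = w * t := by rw [htz, hwt.eq]
  calc z = w * t * z := by rw [← h, hz]
    _ = w * (t * w) := by rw [mul_assoc, ← hzt.eq, h, hwt.eq]
    _ = w * t * w := by rw [mul_assoc]
    _ = w := hw

lemma opInvSqrt_mul_of_commute (hX : X.PosSemidef) (hY : Y.PosSemidef) (h : Commute X Y) :
    opInvSqrt (X * Y) = opInvSqrt X * opInvSqrt Y := by
  have hXY := posSemidef_mul_of_commute hX hY h
  have hrs : Commute (opSqrt X) (opSqrt Y) :=
    (commute_opSqrt_left (commute_opSqrt_left h).symm).symm
  have hrσ : Commute (opSqrt X) (opInvSqrt Y) :=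
    (commute_opInvSqrt_left (commute_opSqrt_left h).symm).symm
  have hρs : Commute (opInvSqrt X) (opSqrt Y) :=
    (commute_opSqrt_left (commute_opInvSqrt_left h).symm).symm
  have hρσ : Commute (opInvSqrt X) (opInvSqrt Y) :=
    (commute_opInvSqrt_left (commute_opInvSqrt_left h).symm).symm
  have hρr := commute_opInvSqrt_opSqrt X
  have hσs := commute_opInvSqrt_opSqrt Y
  have e := opSqrt_mul_of_commute hX hY h
  refine eq_of_commute_of_generalized_inverse (t := opSqrt (X * Y))
    (commute_opInvSqrt_opSqrt _) ?_ (opSqrt_mul_opInvSqrt_mul_opSqrt hXY)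
    (opInvSqrt_mul_opSqrt_mul_opInvSqrt hXY) ?_ ?_
  · rw [e]
    exact (hρr.mul_right hρs).mul_left (hrσ.symm.mul_right hσs)
  · rw [e, hρs.symm.mul_mul_mul_comm, (hrs.symm.mul_left hrσ.symm).mul_mul_mul_comm,
      opSqrt_mul_opInvSqrt_mul_opSqrt hX, opSqrt_mul_opInvSqrt_mul_opSqrt hY]
  · rw [e, hrσ.symm.mul_mul_mul_comm, (hρσ.symm.mul_left hρs.symm).mul_mul_mul_comm,
      opInvSqrt_mul_opSqrt_mul_opInvSqrt hX, opInvSqrt_mul_opSqrt_mul_opInvSqrt hY]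

/-- A power series that represents `f` on `[0, ∞)` also represents it in the functional calculus of
a positive semidefinite operator. -/
lemma hasSum_cfc (hX : X.PosSemidef) {c : ℕ → ℝ} {f : ℝ → ℝ}
    (hf : ∀ x, 0 ≤ x → HasSum (fun n => c n * x ^ n) (f x)) :
    HasSum (fun n => (c n : ℂ) • X ^ n) (cfc f X) := by
  have hX' := hX.isHermitian
  have key : ∀ g : ℝ → ℝ, cfc g X = (hX'.eigenvectorUnitary : EnvOp N) *
      Matrix.diagonal (fun i => (g (hX'.eigenvalues i) : ℂ)) *
        star (hX'.eigenvectorUnitary : EnvOp N) := fun g => by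
    rw [hX'.cfc_eq]; rfl
  have h2 : ∀ n, (c n : ℂ) • X ^ n = cfc (fun x => c n * x ^ n) X := fun n => by
    rw [cfc_const_mul _ _ X (continuousOn_spectrum _ _), cfc_pow_id X n hX'.isSelfAdjoint,
      Complex.coe_smul]
  simp only [h2, key]
  have h3 : HasSum (fun n i => ((c n * hX'.eigenvalues i ^ n : ℝ) : ℂ))
      (fun i => (f (hX'.eigenvalues i) : ℂ)) :=
    Pi.hasSum.2 fun i => Complex.hasSum_ofReal.2 (hf _ (hX.eigenvalues_nonneg i))
  have h4 := HasSum.matrix_diagonal h3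
  exact HasSum.mul_right _ (HasSum.mul_left _ h4)

lemma hasSum_opCos (hX : X.PosSemidef) (t : ℝ) :
    HasSum (fun n : ℕ => (((-1) ^ n * t ^ (2 * n) / (2 * n).factorial : ℝ) : ℂ) • X ^ n)
      (opCos t X) := by
  refine hasSum_cfc hX fun x hx => ?_
  convert Real.hasSum_cos (t * Real.sqrt x) using 2 with n
  rw [mul_pow, pow_mul (Real.sqrt x), Real.sq_sqrt hx]
  ring

lemma hasSum_opSinDiv (hX : X.PosSemidef) (t : ℝ) :
    HasSum (fun n : ℕ => (((-1) ^ n * t ^ (2 * n + 1) / (2 * n + 1).factorial : ℝ) : ℂ) • X ^ n)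
      (opSinDiv t X) := by
  refine hasSum_cfc hX fun x hx => ?_
  by_cases h : x = 0
  -- At `x = 0` only the term `n = 0`, which is `t`, survives.
  · subst h
    simp only [if_true]
    convert hasSum_single 0 fun n hn => ?_ using 1
    · simp
    · simp [hn]
  · have h' : Real.sqrt x ≠ 0 := (Real.sqrt_pos.2 (lt_of_le_of_ne hx (Ne.symm h))).ne'
    simp only [if_neg h]
    refine ((Real.hasSum_sin (t * Real.sqrt x)).div_const (Real.sqrt x)).congr_fun fun n => ?_
    rw [mul_pow, pow_succ (Real.sqrt x), pow_mul (Real.sqrt x), Real.sq_sqrt hx]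
    field_simp

end FunctionalCalculus

/-! ### Column identities for a pair of commuting ladder operators -/

/-- Operators `A`, `B` with adjoints `A'`, `B'`, acting on different baths: each of `A`, `A'`
commutes with each of `B`, `B'`. The column of the time evolution that starts in a given
configuration of the central spins is governed by such a pair, `A` being the bath operator that
accompanies a flip of the first spin and `B` that of the second. -/
structure LadderPair {N : ℕ} (A A' B B' : EnvOp N) : Prop where
  adjoint_left : A' = Aᴴ
  adjoint_right : B' = Bᴴ
  commute : Commute A B
  commute_adjoint : Commute A B'
  adjoint_commute : Commute A' B
  adjoint_commute_adjoint : Commute A' B'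

namespace LadderPair

open scoped ComplexOrder

variable {N : ℕ} {A A' B B' : EnvOp N}

lemma swap (h : LadderPair A A' B B') : LadderPair B B' A A' :=
  ⟨h.adjoint_right, h.adjoint_left, h.commute.symm, h.adjoint_commute.symm,
    h.commute_adjoint.symm, h.adjoint_commute_adjoint.symm⟩

lemma posSemidef (h : LadderPair A A' B B') : (A' * A).PosSemidef := by
  rw [h.adjoint_left]
  exact Matrix.posSemidef_conjTranspose_mul_self A

lemma commute_left (h : LadderPair A A' B B') : Commute (A' * A) B :=
  h.adjoint_commute.mul_left h.commute

lemma commute_left_adjoint (h : LadderPair A A' B B') : Commute (A' * A) B' :=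
  h.adjoint_commute_adjoint.mul_left h.commute_adjoint

lemma commute_sq (h : LadderPair A A' B B') : Commute (A' * A) (B' * B) :=
  h.commute_left_adjoint.mul_right h.commute_left

lemma commute_opSqrt (h : LadderPair A A' B B') : Commute (opSqrt (A' * A)) (opSqrt (B' * B)) :=
  (commute_opSqrt_left (commute_opSqrt_left h.commute_sq).symm).symm

lemma opInvSqrt_mul (h : LadderPair A A' B B') :
    opInvSqrt (A' * A * B' * B) = opInvSqrt (A' * A) * opInvSqrt (B' * B) := by
  rw [mul_assoc (A' * A)]
  exact opInvSqrt_mul_of_commute h.posSemidef h.swap.posSemidef h.commute_sq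

lemma opInvSqrt_mul_comm (h : LadderPair A A' B B') :
    opInvSqrt (A' * A * B' * B) = opInvSqrt (B' * B * A' * A) := by
  rw [mul_assoc (A' * A), mul_assoc (B' * B), h.commute_sq.eq]

lemma mul_opInvSqrt_mul_opSqrt (h : LadderPair A A' B B') :
    A * opInvSqrt (A' * A) * opSqrt (A' * A) = A := by
  rw [mul_assoc, h.adjoint_left, SpinStar.mul_opInvSqrt_mul_opSqrt]

/-- After the flip of both spins, undoing the first flip produces a factor `√(A' A)`. -/
lemma adjoint_mul_mul_opInvSqrt (h : LadderPair A A' B B') :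
    A' * (A * B * opInvSqrt (A' * A * B' * B)) =
      B * opInvSqrt (B' * B) * opSqrt (A' * A) := by
  have hc : Commute (opSqrt (A' * A)) (opInvSqrt (B' * B)) :=
    (commute_opInvSqrt_left (commute_opSqrt_left h.commute_sq).symm).symm
  rw [h.opInvSqrt_mul]
  calc _ = A' * A * B * opInvSqrt (A' * A) * opInvSqrt (B' * B) := by simp only [mul_assoc]
    _ = B * (A' * A * opInvSqrt (A' * A)) * opInvSqrt (B' * B) := by
        rw [h.commute_left.eq]; simp only [mul_assoc]
    _ = _ := by rw [mul_opInvSqrt h.posSemidef, mul_assoc, hc.eq, mul_assoc]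

/-- The polar factors `A (A' A)^{-1/2}` and `B (B' B)^{-1/2}` compose to that of the double flip. -/
lemma mul_mul_opInvSqrt (h : LadderPair A A' B B') :
    A * (B * opInvSqrt (B' * B)) = A * B * opInvSqrt (A' * A * B' * B) * opSqrt (A' * A) := by
  have hc : Commute (opSqrt (A' * A)) (opInvSqrt (B' * B)) :=
    (commute_opInvSqrt_left (commute_opSqrt_left h.commute_sq).symm).symm
  have hB : Commute (opInvSqrt (A' * A) * opSqrt (A' * A)) B :=
    (commute_opInvSqrt_left h.commute_left).mul_left (commute_opSqrt_left h.commute_left)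
  rw [h.opInvSqrt_mul]
  symm
  calc _ = A * (B * (opInvSqrt (A' * A) * opSqrt (A' * A))) * opInvSqrt (B' * B) := by
        simp only [mul_assoc, hc.eq]
    _ = A * opInvSqrt (A' * A) * opSqrt (A' * A) * B * opInvSqrt (B' * B) := by
        rw [← hB.eq]; simp only [mul_assoc]
    _ = _ := by rw [h.mul_opInvSqrt_mul_opSqrt, mul_assoc]

lemma smul_mul_opInvSqrt (h : LadderPair A A' B B') (hN : 1 ≤ N) (α : ℝ) (Z : EnvOp N) :
    (α / 2 : ℂ) • (A * opInvSqrt ((N : ℂ) • (A' * A)) * Z) =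
      (((α / Real.sqrt N : ℝ) : ℂ) / 2) • (A * opInvSqrt (A' * A) * Z) := by
  have hN' : (0 : ℝ) < N := by exact_mod_cast hN
  have e : (N : ℂ) • (A' * A) = (N : ℝ) • (A' * A) := by
    rw [← Complex.coe_smul]; simp
  rw [e, opInvSqrt_smul h.posSemidef hN', ← Complex.coe_smul, mul_smul_comm, smul_mul_assoc,
    smul_smul]
  congr 1
  push_cast
  ring

/-! The next lemmas describe the action of `H` on one column of the matrices of even and odd powers,
for arbitrary operators `x`, `y` in place of powers of `𝓜^±`. The four components of the column
belong to no flip, a flip of the second spin, a flip of the first spin, and both flips. The scalar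
`d` is the eigenvalue `±δ` of `4 δ S¹_z S²_z` on the initial configuration; after one flip the
eigenvalue is `d' = -d`. The summands of a component of `H v` come in the fixed order: diagonal part
of `H`, coupling of the second spin, coupling of the first spin. -/

section Columns

variable (h : LadderPair A A' B B') (hN : 1 ≤ N) (α : ℝ) {d d' u : ℂ} (x y : EnvOp N)

/-- The components of `H E` without a flip and with both flips; the components of
`E` with a single flip, which `H` couples to these, vanish. -/
lemma even_self (hu : u = d / 2) (c : ℂ) (S T Z : EnvOp N) :
    d • ((1 / 2 : ℂ) • Z) + c • (S * 0) + c • (T * 0) = u • Z := by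
  simp only [mul_zero, smul_zero, add_zero, smul_smul, hu]
  ring_nf

include h hN

/-- The component of `H E` in which the second spin is flipped. -/
lemma even_right :
    d' • (0 : EnvOp N) + ((α / Real.sqrt N : ℝ) : ℂ) • (B * ((1 / 2 : ℂ) • (x + y))) +
      ((α / Real.sqrt N : ℝ) : ℂ) •
        (A' * ((1 / 2 : ℂ) • (A * B * opInvSqrt (A' * A * B' * B) * (x - y)))) =
    (α / 2 : ℂ) • (B * opInvSqrt ((N : ℂ) • (B' * B)) *
      ((opSqrt (B' * B) + opSqrt (A' * A)) * x + (opSqrt (B' * B) - opSqrt (A' * A)) * y)) := by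
  rw [h.swap.smul_mul_opInvSqrt hN, mul_smul_comm, mul_smul_comm, ← mul_assoc A',
    h.adjoint_mul_mul_opInvSqrt]
  simp only [mul_add, mul_sub, add_mul, sub_mul, ← mul_assoc, h.swap.mul_opInvSqrt_mul_opSqrt]
  module

/-- The component of `H E` in which the first spin is flipped. -/
lemma even_left :
    d' • (0 : EnvOp N) + ((α / Real.sqrt N : ℝ) : ℂ) •
        (B' * ((1 / 2 : ℂ) • (A * B * opInvSqrt (A' * A * B' * B) * (x - y)))) +
      ((α / Real.sqrt N : ℝ) : ℂ) • (A * ((1 / 2 : ℂ) • (x + y))) =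
    (α / 2 : ℂ) • (A * opInvSqrt ((N : ℂ) • (A' * A)) *
      ((opSqrt (A' * A) + opSqrt (B' * B)) * x + (opSqrt (A' * A) - opSqrt (B' * B)) * y)) := by
  rw [h.commute.eq, h.opInvSqrt_mul_comm, ← h.swap.even_right (d' := d') hN, add_right_comm]

/-- The component of `H O` in which the second spin is flipped; it vanishes because the
diagonal part of `H` anticommutes with the coupling to the baths. -/
lemma odd_right (hd' : d' = -d) (hu : u = d / 2) :
    d' • ((α / 2 : ℂ) • (B * opInvSqrt ((N : ℂ) • (B' * B)) *
        ((opSqrt (B' * B) + opSqrt (A' * A)) * x + (opSqrt (B' * B) - opSqrt (A' * A)) * y))) +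
      ((α / Real.sqrt N : ℝ) : ℂ) • (B * (u • (x + y))) +
      ((α / Real.sqrt N : ℝ) : ℂ) •
        (A' * (u • (A * B * opInvSqrt (A' * A * B' * B) * (x - y)))) = 0 := by
  rw [← h.even_right (d' := 0) hN, hd', hu]
  simp only [mul_smul_comm]
  module

/-- The component of `H O` in which the first spin is flipped. -/
lemma odd_left (hd' : d' = -d) (hu : u = d / 2) :
    d' • ((α / 2 : ℂ) • (A * opInvSqrt ((N : ℂ) • (A' * A)) *
        ((opSqrt (A' * A) + opSqrt (B' * B)) * x + (opSqrt (A' * A) - opSqrt (B' * B)) * y))) +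
      ((α / Real.sqrt N : ℝ) : ℂ) •
        (B' * (u • (A * B * opInvSqrt (A' * A * B' * B) * (x - y)))) +
      ((α / Real.sqrt N : ℝ) : ℂ) • (A * (u • (x + y))) = 0 := by
  rw [h.commute.eq, h.opInvSqrt_mul_comm, ← h.swap.odd_right hN α x y hd' hu, add_right_comm]

/-- The component of `H O` without a flip. -/
lemma odd_diag {δ : ℝ} (hd : d ^ 2 = δ ^ 2) (hu : u = d / 2) :
    d • (u • (x + y)) +
      ((α / Real.sqrt N : ℝ) : ℂ) • (B' * ((α / 2 : ℂ) • (B * opInvSqrt ((N : ℂ) • (B' * B)) *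
        ((opSqrt (B' * B) + opSqrt (A' * A)) * x +
          (opSqrt (B' * B) - opSqrt (A' * A)) * y)))) +
      ((α / Real.sqrt N : ℝ) : ℂ) • (A' * ((α / 2 : ℂ) • (A * opInvSqrt ((N : ℂ) • (A' * A)) *
        ((opSqrt (A' * A) + opSqrt (B' * B)) * x +
          (opSqrt (A' * A) - opSqrt (B' * B)) * y)))) =
    (1 / 2 : ℂ) • (Mplus δ α (A' * A) (B' * B) * x + Mminus δ α (A' * A) (B' * B) * y) := by
  have hd2 : ((δ ^ 2 : ℝ) : ℂ) = d * d := by rw [← sq, hd, Complex.ofReal_pow]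
  have hc : ((α ^ 2 / N : ℝ) : ℂ) = ((α / Real.sqrt N : ℝ) : ℂ) ^ 2 := by
    rw [← Complex.ofReal_pow, div_pow, Real.sq_sqrt (Nat.cast_nonneg N)]
  have hA : A' * (A * opInvSqrt (A' * A)) = opSqrt (A' * A) := by
    rw [← mul_assoc, mul_opInvSqrt h.posSemidef]
  have hB : B' * (B * opInvSqrt (B' * B)) = opSqrt (B' * B) := by
    rw [← mul_assoc, mul_opInvSqrt h.swap.posSemidef]
  rw [h.smul_mul_opInvSqrt hN, h.swap.smul_mul_opInvSqrt hN, mul_smul_comm, mul_smul_comm,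
    ← mul_assoc A', ← mul_assoc B', hA, hB, Mplus, Mminus, hc, hd2, hu]
  simp only [sq, mul_add, mul_sub, add_mul, sub_mul, ← mul_assoc, smul_mul_assoc, one_mul,
    h.commute_opSqrt.eq]
  module

/-- The component of `H O` with both flips. It uses `r (s + r) + s (r + s) = (r + s)²` and
`r (s - r) + s (r - s) = -(r - s)²` for `r = √(A' A)`, `s = √(B' B)`. -/
lemma odd_both {δ : ℝ} (hd : d ^ 2 = δ ^ 2) (hu : u = d / 2) :
    d • (u • (A * B * opInvSqrt (A' * A * B' * B) * (x - y))) +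
      ((α / Real.sqrt N : ℝ) : ℂ) • (B * ((α / 2 : ℂ) • (A * opInvSqrt ((N : ℂ) • (A' * A)) *
        ((opSqrt (A' * A) + opSqrt (B' * B)) * x +
          (opSqrt (A' * A) - opSqrt (B' * B)) * y)))) +
      ((α / Real.sqrt N : ℝ) : ℂ) • (A * ((α / 2 : ℂ) • (B * opInvSqrt ((N : ℂ) • (B' * B)) *
        ((opSqrt (B' * B) + opSqrt (A' * A)) * x +
          (opSqrt (B' * B) - opSqrt (A' * A)) * y)))) =
    (1 / 2 : ℂ) • (A * B * opInvSqrt (A' * A * B' * B) *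
      (Mplus δ α (A' * A) (B' * B) * x - Mminus δ α (A' * A) (B' * B) * y)) := by
  have hd2 : ((δ ^ 2 : ℝ) : ℂ) = d * d := by rw [← sq, hd, Complex.ofReal_pow]
  have hc : ((α ^ 2 / N : ℝ) : ℂ) = ((α / Real.sqrt N : ℝ) : ℂ) ^ 2 := by
    rw [← Complex.ofReal_pow, div_pow, Real.sq_sqrt (Nat.cast_nonneg N)]
  rw [h.smul_mul_opInvSqrt hN, h.swap.smul_mul_opInvSqrt hN, mul_smul_comm, mul_smul_comm,
    ← mul_assoc A, ← mul_assoc B, h.mul_mul_opInvSqrt, h.swap.mul_mul_opInvSqrt,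
    ← h.commute.eq, ← h.opInvSqrt_mul_comm, Mplus, Mminus, hc, hd2, hu]
  generalize A * B * opInvSqrt (A' * A * B' * B) = T
  have e := h.commute_opSqrt.eq
  generalize opSqrt (A' * A) = r at *
  generalize opSqrt (B' * B) = s at *
  have e' : T * r * s = T * s * r := by rw [mul_assoc, e, mul_assoc]
  simp only [sq, mul_add, mul_sub, add_mul, sub_mul, ← mul_assoc, smul_mul_assoc, one_mul,
    mul_smul_comm, e']
  module

end Columns

end LadderPair

/-! ### The ladder operators of the baths -/

variable {N : ℕ}

lemma siteOp_conjTranspose (k : Fin N) (A : Matrix (Fin 2) (Fin 2) ℂ) :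
    (siteOp k A)ᴴ = siteOp k Aᴴ := by
  ext σ τ
  simp only [siteOp, Matrix.conjTranspose_apply, Matrix.of_apply, star_prod]
  refine Finset.prod_congr rfl fun l _ => ?_
  split_ifs
  · rfl
  · rw [← Matrix.conjTranspose_apply, Matrix.conjTranspose_one]

lemma totalSpin_conjTranspose (N : ℕ) (A : Matrix (Fin 2) (Fin 2) ℂ) :
    (totalSpin N A)ᴴ = totalSpin N Aᴴ := by
  simp [totalSpin, Matrix.conjTranspose_sum, siteOp_conjTranspose]

lemma Sp_conjTranspose : Spᴴ = Sm := by
  ext i j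
  fin_cases i <;> fin_cases j <;> simp [Sp, Sm]

lemma Jp_conjTranspose (N : ℕ) : (Jp N)ᴴ = Jm N := by
  rw [Jp, Matrix.conjTranspose_kronecker, totalSpin_conjTranspose, Sp_conjTranspose,
    Matrix.conjTranspose_one, Jm]

lemma Jm_conjTranspose (N : ℕ) : (Jm N)ᴴ = Jp N := by
  rw [← Jp_conjTranspose, Matrix.conjTranspose_conjTranspose]

lemma Kp_conjTranspose (N : ℕ) : (Kp N)ᴴ = Km N := by
  rw [Kp, Matrix.conjTranspose_kronecker, totalSpin_conjTranspose, Sp_conjTranspose,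
    Matrix.conjTranspose_one, Km]

lemma Km_conjTranspose (N : ℕ) : (Km N)ᴴ = Kp N := by
  rw [← Kp_conjTranspose, Matrix.conjTranspose_conjTranspose]

lemma commute_kronecker_one_one_kronecker (S T : BathOp N) :
    Commute (S ⊗ₖ (1 : BathOp N)) ((1 : BathOp N) ⊗ₖ T) := by
  rw [commute_iff_eq, ← Matrix.mul_kronecker_mul, ← Matrix.mul_kronecker_mul]
  simp

lemma ladderPair_minus_minus (N : ℕ) : LadderPair (Jm N) (Jp N) (Km N) (Kp N) where
  adjoint_left := (Jm_conjTranspose N).symm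
  adjoint_right := (Km_conjTranspose N).symm
  commute := commute_kronecker_one_one_kronecker _ _
  commute_adjoint := commute_kronecker_one_one_kronecker _ _
  adjoint_commute := commute_kronecker_one_one_kronecker _ _
  adjoint_commute_adjoint := commute_kronecker_one_one_kronecker _ _

lemma ladderPair_minus_plus (N : ℕ) : LadderPair (Jm N) (Jp N) (Kp N) (Km N) where
  adjoint_left := (Jm_conjTranspose N).symm
  adjoint_right := (Kp_conjTranspose N).symm
  commute := commute_kronecker_one_one_kronecker _ _
  commute_adjoint := commute_kronecker_one_one_kronecker _ _
  adjoint_commute := commute_kronecker_one_one_kronecker _ _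
  adjoint_commute_adjoint := commute_kronecker_one_one_kronecker _ _

lemma ladderPair_plus_minus (N : ℕ) : LadderPair (Jp N) (Jm N) (Km N) (Kp N) where
  adjoint_left := (Jp_conjTranspose N).symm
  adjoint_right := (Km_conjTranspose N).symm
  commute := commute_kronecker_one_one_kronecker _ _
  commute_adjoint := commute_kronecker_one_one_kronecker _ _
  adjoint_commute := commute_kronecker_one_one_kronecker _ _
  adjoint_commute_adjoint := commute_kronecker_one_one_kronecker _ _

lemma ladderPair_plus_plus (N : ℕ) : LadderPair (Jp N) (Jm N) (Kp N) (Km N) where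
  adjoint_left := (Jp_conjTranspose N).symm
  adjoint_right := (Kp_conjTranspose N).symm
  commute := commute_kronecker_one_one_kronecker _ _
  commute_adjoint := commute_kronecker_one_one_kronecker _ _
  adjoint_commute := commute_kronecker_one_one_kronecker _ _
  adjoint_commute_adjoint := commute_kronecker_one_one_kronecker _ _

/-! ### Operator-valued entries -/

lemma sum_chi {M : Type*} [AddCommMonoid M] (f : Fin 2 × Fin 2 → M) :
    ∑ p, f p = ∑ k, f (chi k) := by
  simp [Fintype.sum_prod_type, Fin.sum_univ_four, Fin.sum_univ_two, chi, add_assoc]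

lemma blocks_mul (S T : TotalOp N) : blocks (S * T) = blocks S * blocks T := by
  ext i j e f
  simp only [blocks, Matrix.of_apply, Matrix.submatrix_apply, Matrix.mul_apply,
    Fintype.sum_prod_type (f := fun p : (Fin 2 × Fin 2) × (Bath N × Bath N) => _),
    Matrix.sum_apply]
  exact sum_chi _

lemma blocks_one : blocks (1 : TotalOp N) = 1 := by
  ext i j e f
  fin_cases i <;> fin_cases j <;> simp [blocks, chi, Matrix.one_apply]

lemma blocks_H_apply (δ α : ℝ) (i j : Fin 4) :
    blocks (H N δ α) i j =
      (4 * δ * (Sz (chi i).1 (chi j).1 * Sz (chi i).2 (chi j).2) : ℂ) • (1 : EnvOp N) +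
      ((α / Real.sqrt N : ℝ) : ℂ) •
        ((Sp (chi i).1 (chi j).1 * (1 : Matrix (Fin 2) (Fin 2) ℂ) (chi i).2 (chi j).2) • Jm N +
        (Sm (chi i).1 (chi j).1 * (1 : Matrix (Fin 2) (Fin 2) ℂ) (chi i).2 (chi j).2) • Jp N +
        ((1 : Matrix (Fin 2) (Fin 2) ℂ) (chi i).1 (chi j).1 * Sp (chi i).2 (chi j).2) • Km N +
        ((1 : Matrix (Fin 2) (Fin 2) ℂ) (chi i).1 (chi j).1 * Sm (chi i).2 (chi j).2) • Kp N) := by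
  rw [mul_smul, H, qubit1, qubit2, ← Matrix.mul_kronecker_mul, Matrix.mul_one, Matrix.one_mul]
  rfl

/-! Row `i` of `H T`, with the summands in the order: diagonal part of `H`, coupling of the second
spin, coupling of the first spin. -/

lemma blocks_H_mul_zero (δ α : ℝ) (T : Matrix (Fin 4) (Fin 4) (EnvOp N)) (j : Fin 4) :
    (blocks (H N δ α) * T) 0 j = (δ : ℂ) • T 0 j +
      ((α / Real.sqrt N : ℝ) : ℂ) • (Kp N * T 1 j) +
      ((α / Real.sqrt N : ℝ) : ℂ) • (Jp N * T 2 j) := by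
  simp [Matrix.mul_apply, Fin.sum_univ_four, blocks_H_apply, chi, Sz, Sp, Sm, Matrix.one_apply,
    -Complex.coe_smul]
  ring_nf

lemma blocks_H_mul_one (δ α : ℝ) (T : Matrix (Fin 4) (Fin 4) (EnvOp N)) (j : Fin 4) :
    (blocks (H N δ α) * T) 1 j = (-δ : ℂ) • T 1 j +
      ((α / Real.sqrt N : ℝ) : ℂ) • (Km N * T 0 j) +
      ((α / Real.sqrt N : ℝ) : ℂ) • (Jp N * T 3 j) := by
  simp [Matrix.mul_apply, Fin.sum_univ_four, blocks_H_apply, chi, Sz, Sp, Sm, Matrix.one_apply,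
    -Complex.coe_smul]
  ring_nf
  abel

lemma blocks_H_mul_two (δ α : ℝ) (T : Matrix (Fin 4) (Fin 4) (EnvOp N)) (j : Fin 4) :
    (blocks (H N δ α) * T) 2 j = (-δ : ℂ) • T 2 j +
      ((α / Real.sqrt N : ℝ) : ℂ) • (Kp N * T 3 j) +
      ((α / Real.sqrt N : ℝ) : ℂ) • (Jm N * T 0 j) := by
  simp [Matrix.mul_apply, Fin.sum_univ_four, blocks_H_apply, chi, Sz, Sp, Sm, Matrix.one_apply,
    -Complex.coe_smul]
  ring_nf
  abel

lemma blocks_H_mul_three (δ α : ℝ) (T : Matrix (Fin 4) (Fin 4) (EnvOp N)) (j : Fin 4) :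
    (blocks (H N δ α) * T) 3 j = (δ : ℂ) • T 3 j +
      ((α / Real.sqrt N : ℝ) : ℂ) • (Km N * T 2 j) +
      ((α / Real.sqrt N : ℝ) : ℂ) • (Jm N * T 1 j) := by
  simp [Matrix.mul_apply, Fin.sum_univ_four, blocks_H_apply, chi, Sz, Sp, Sm, Matrix.one_apply,
    -Complex.coe_smul]
  ring_nf
  abel

/-! ### Even and odd powers of the Hamiltonian -/

/-- Families `x_j^±` of operators on the baths, `1 ≤ j ≤ 4`. The index `j` is represented by
`j - 1 : Fin 4`, the sign `+` by `true` and `-` by `false`. -/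
abbrev ModeFamily (N : ℕ) : Type := Fin 4 → Bool → EnvOp N

/-- The operators `𝓜_j^±`. -/
noncomputable def modes (N : ℕ) (δ α : ℝ) : ModeFamily N :=
  ![fun b => cond b (M1p N δ α) (M1m N δ α), fun b => cond b (M2p N δ α) (M2m N δ α),
    fun b => cond b (M3p N δ α) (M3m N δ α), fun b => cond b (M4p N δ α) (M4m N δ α)]

/-- The linear map `x ↦ x_j^±`. -/
def modeProj (N : ℕ) (j : Fin 4) (b : Bool) : ModeFamily N →ₗ[ℂ] EnvOp N :=
  LinearMap.proj b ∘ₗ LinearMap.proj j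

/-- The linear map `x ↦ c (x_j^+ + x_j^-)`. -/
def modeSum (N : ℕ) (c : ℂ) (j : Fin 4) : ModeFamily N →ₗ[ℂ] EnvOp N :=
  c • (modeProj N j true + modeProj N j false)

/-- The linear map `x ↦ c T (x_j^+ - x_j^-)`. -/
def modeDiff (c : ℂ) (T : EnvOp N) (j : Fin 4) : ModeFamily N →ₗ[ℂ] EnvOp N :=
  c • (LinearMap.mulLeft ℂ T ∘ₗ (modeProj N j true - modeProj N j false))

/-- The linear map `x ↦ c T ((p + q) x_j^+ + (p - q) x_j^-)`. -/
def modeMix (c : ℂ) (T p q : EnvOp N) (j : Fin 4) : ModeFamily N →ₗ[ℂ] EnvOp N :=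
  c • (LinearMap.mulLeft ℂ T ∘ₗ (LinearMap.mulLeft ℂ (p + q) ∘ₗ modeProj N j true +
    LinearMap.mulLeft ℂ (p - q) ∘ₗ modeProj N j false))

/-- The entries, as linear functions of a family `x_j^±`, of the even part of an entire function of
`H`. If that part is `f(H²)`, the entries are to be evaluated at `x_j^± = f(𝓜_j^±)`. -/
noncomputable def evenEntries (N : ℕ) :
    Matrix (Fin 4) (Fin 4) (ModeFamily N →ₗ[ℂ] EnvOp N) :=
  !![modeSum N (1 / 2) 0,
    0,
    0,
    modeDiff (1 / 2) (Jp N * Kp N * opInvSqrt (Jm N * Jp N * Km N * Kp N)) 3;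
    0,
    modeSum N (1 / 2) 1,
    modeDiff (1 / 2) (Jp N * Km N * opInvSqrt (Jm N * Jp N * Kp N * Km N)) 2,
    0;
    0,
    modeDiff (1 / 2) (Jm N * Kp N * opInvSqrt (Jp N * Jm N * Km N * Kp N)) 1,
    modeSum N (1 / 2) 2,
    0;
    modeDiff (1 / 2) (Jm N * Km N * opInvSqrt (Jp N * Jm N * Kp N * Km N)) 0,
    0,
    0,
    modeSum N (1 / 2) 3]

/-- The entries, as linear functions of a family `x_j^±`, of the odd part of an entire function of
`H`. If that part is `H f(H²)`, the entries are to be evaluated at `x_j^± = f(𝓜_j^±)`. -/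
noncomputable def oddEntries (N : ℕ) (δ α : ℝ) :
    Matrix (Fin 4) (Fin 4) (ModeFamily N →ₗ[ℂ] EnvOp N) :=
  !![modeSum N (δ / 2) 0,
    modeMix (α / 2) (Kp N * opInvSqrt ((N : ℂ) • (Km N * Kp N))) (s₂ N) (r₁ N) 1,
    modeMix (α / 2) (Jp N * opInvSqrt ((N : ℂ) • (Jm N * Jp N))) (r₂ N) (s₁ N) 2,
    modeDiff (δ / 2) (Jp N * Kp N * opInvSqrt (Jm N * Jp N * Km N * Kp N)) 3;
    modeMix (α / 2) (Km N * opInvSqrt ((N : ℂ) • (Kp N * Km N))) (s₁ N) (r₁ N) 0,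
    modeSum N (-(δ / 2)) 1,
    modeDiff (-(δ / 2)) (Jp N * Km N * opInvSqrt (Jm N * Jp N * Kp N * Km N)) 2,
    modeMix (α / 2) (Jp N * opInvSqrt ((N : ℂ) • (Jm N * Jp N))) (r₂ N) (s₂ N) 3;
    modeMix (α / 2) (Jm N * opInvSqrt ((N : ℂ) • (Jp N * Jm N))) (r₁ N) (s₁ N) 0,
    modeDiff (-(δ / 2)) (Jm N * Kp N * opInvSqrt (Jp N * Jm N * Km N * Kp N)) 1,
    modeSum N (-(δ / 2)) 2,
    modeMix (α / 2) (Kp N * opInvSqrt ((N : ℂ) • (Km N * Kp N))) (s₂ N) (r₂ N) 3;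
    modeDiff (δ / 2) (Jm N * Km N * opInvSqrt (Jp N * Jm N * Kp N * Km N)) 0,
    modeMix (α / 2) (Jm N * opInvSqrt ((N : ℂ) • (Jp N * Jm N))) (r₁ N) (s₂ N) 1,
    modeMix (α / 2) (Km N * opInvSqrt ((N : ℂ) • (Kp N * Km N))) (s₁ N) (r₂ N) 2,
    modeSum N (δ / 2) 3]

/-- The matrix of the values of `evenEntries` at a family `x_j^±`. -/
noncomputable def evenBlocks (N : ℕ) (x : ModeFamily N) : Matrix (Fin 4) (Fin 4) (EnvOp N) :=
  Matrix.of fun i j => evenEntries N i j x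

/-- The matrix of the values of `oddEntries` at a family `x_j^±`. -/
noncomputable def oddBlocks (N : ℕ) (δ α : ℝ) (x : ModeFamily N) :
    Matrix (Fin 4) (Fin 4) (EnvOp N) :=
  Matrix.of fun i j => oddEntries N δ α i j x

lemma blocks_H_mul_evenBlocks (hN : 1 ≤ N) (δ α : ℝ) (x : ModeFamily N) :
    blocks (H N δ α) * evenBlocks N x = oddBlocks N δ α x := by
  -- The four columns are governed by `h1`, …, `h4`, with `d = δ` in the first and last column and
  -- `d = -δ` in the two middle ones.
  have h1 := ladderPair_minus_minus N
  have h2 := ladderPair_minus_plus N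
  have h3 := ladderPair_plus_minus N
  have h4 := ladderPair_plus_plus N
  have hn : -((δ : ℂ) / 2) = -δ / 2 := by ring
  ext1 i j
  fin_cases j <;> fin_cases i
  · exact (blocks_H_mul_zero δ α _ _).trans (LadderPair.even_self rfl _ _ _ _)
  · exact (blocks_H_mul_one δ α _ _).trans (h1.even_right hN α (x 0 true) (x 0 false))
  · exact (blocks_H_mul_two δ α _ _).trans (h1.even_left hN α (x 0 true) (x 0 false))
  · exact (blocks_H_mul_three δ α _ _).trans (LadderPair.even_self rfl _ _ _ _)
  · exact (blocks_H_mul_zero δ α _ _).trans (h2.even_right hN α (x 1 true) (x 1 false))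
  · exact (blocks_H_mul_one δ α _ _).trans (LadderPair.even_self hn _ _ _ _)
  · exact (blocks_H_mul_two δ α _ _).trans (LadderPair.even_self hn _ _ _ _)
  · exact (blocks_H_mul_three δ α _ _).trans (h2.even_left hN α (x 1 true) (x 1 false))
  · exact (blocks_H_mul_zero δ α _ _).trans (h3.even_left hN α (x 2 true) (x 2 false))
  · exact (blocks_H_mul_one δ α _ _).trans (LadderPair.even_self hn _ _ _ _)
  · exact (blocks_H_mul_two δ α _ _).trans (LadderPair.even_self hn _ _ _ _)
  · exact (blocks_H_mul_three δ α _ _).trans (h3.even_right hN α (x 2 true) (x 2 false))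
  · exact (blocks_H_mul_zero δ α _ _).trans (LadderPair.even_self rfl _ _ _ _)
  · exact (blocks_H_mul_one δ α _ _).trans (h4.even_left hN α (x 3 true) (x 3 false))
  · exact (blocks_H_mul_two δ α _ _).trans (h4.even_right hN α (x 3 true) (x 3 false))
  · exact (blocks_H_mul_three δ α _ _).trans (LadderPair.even_self rfl _ _ _ _)

lemma blocks_H_mul_oddBlocks (hN : 1 ≤ N) (δ α : ℝ) (x : ModeFamily N) :
    blocks (H N δ α) * oddBlocks N δ α x = evenBlocks N (modes N δ α * x) := by
  -- The four columns are governed by `h1`, …, `h4`, with `d = δ` in the first and last column and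
  -- `d = -δ` in the two middle ones.
  have h1 := ladderPair_minus_minus N
  have h2 := ladderPair_minus_plus N
  have h3 := ladderPair_plus_minus N
  have h4 := ladderPair_plus_plus N
  have hn : -((δ : ℂ) / 2) = -δ / 2 := by ring
  ext1 i j
  fin_cases j <;> fin_cases i
  · exact (blocks_H_mul_zero δ α _ _).trans
      (h1.odd_diag (δ := δ) (d := δ) (u := δ / 2) hN α (x 0 true) (x 0 false) rfl rfl)
  · exact (blocks_H_mul_one δ α _ _).trans
      (h1.odd_right (d := δ) (d' := -δ) (u := δ / 2) hN α (x 0 true) (x 0 false) rfl rfl)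
  · exact (blocks_H_mul_two δ α _ _).trans
      (h1.odd_left (d := δ) (d' := -δ) (u := δ / 2) hN α (x 0 true) (x 0 false) rfl rfl)
  · exact (blocks_H_mul_three δ α _ _).trans
      (h1.odd_both (δ := δ) (d := δ) (u := δ / 2) hN α (x 0 true) (x 0 false) rfl rfl)
  · exact (blocks_H_mul_zero δ α _ _).trans
      (h2.odd_right (d := -δ) (d' := δ) (u := -(δ / 2)) hN α (x 1 true) (x 1 false)
        (neg_neg _).symm hn)
  · exact (blocks_H_mul_one δ α _ _).trans
      (h2.odd_diag (δ := δ) (d := -δ) (u := -(δ / 2)) hN α (x 1 true) (x 1 false) (neg_sq _) hn)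
  · exact (blocks_H_mul_two δ α _ _).trans
      (h2.odd_both (δ := δ) (d := -δ) (u := -(δ / 2)) hN α (x 1 true) (x 1 false) (neg_sq _) hn)
  · exact (blocks_H_mul_three δ α _ _).trans
      (h2.odd_left (d := -δ) (d' := δ) (u := -(δ / 2)) hN α (x 1 true) (x 1 false)
        (neg_neg _).symm hn)
  · exact (blocks_H_mul_zero δ α _ _).trans
      (h3.odd_left (d := -δ) (d' := δ) (u := -(δ / 2)) hN α (x 2 true) (x 2 false)
        (neg_neg _).symm hn)
  · exact (blocks_H_mul_one δ α _ _).trans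
      (h3.odd_both (δ := δ) (d := -δ) (u := -(δ / 2)) hN α (x 2 true) (x 2 false) (neg_sq _) hn)
  · exact (blocks_H_mul_two δ α _ _).trans
      (h3.odd_diag (δ := δ) (d := -δ) (u := -(δ / 2)) hN α (x 2 true) (x 2 false) (neg_sq _) hn)
  · exact (blocks_H_mul_three δ α _ _).trans
      (h3.odd_right (d := -δ) (d' := δ) (u := -(δ / 2)) hN α (x 2 true) (x 2 false)
        (neg_neg _).symm hn)
  · exact (blocks_H_mul_zero δ α _ _).trans
      (h4.odd_both (δ := δ) (d := δ) (u := δ / 2) hN α (x 3 true) (x 3 false) rfl rfl)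
  · exact (blocks_H_mul_one δ α _ _).trans
      (h4.odd_left (d := δ) (d' := -δ) (u := δ / 2) hN α (x 3 true) (x 3 false) rfl rfl)
  · exact (blocks_H_mul_two δ α _ _).trans
      (h4.odd_right (d := δ) (d' := -δ) (u := δ / 2) hN α (x 3 true) (x 3 false) rfl rfl)
  · exact (blocks_H_mul_three δ α _ _).trans
      (h4.odd_diag (δ := δ) (d := δ) (u := δ / 2) hN α (x 3 true) (x 3 false) rfl rfl)

lemma evenBlocks_one (N : ℕ) : evenBlocks N 1 = 1 := by
  have hs : (1 / 2 : ℂ) • ((1 : EnvOp N) + 1) = 1 := by module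
  have hd (T : EnvOp N) : (1 / 2 : ℂ) • (T * (1 - 1)) = 0 := by
    rw [sub_self, mul_zero, smul_zero]
  ext1 i j
  fin_cases i <;> fin_cases j <;> first | exact hs | exact hd _ | rfl

lemma blocks_H_pow_even (hN : 1 ≤ N) (δ α : ℝ) (n : ℕ) :
    blocks (H N δ α ^ (2 * n)) = evenBlocks N (modes N δ α ^ n) := by
  induction n with
  | zero => rw [mul_zero, pow_zero, pow_zero, blocks_one, evenBlocks_one]
  | succ n ih =>
    rw [mul_add, mul_one, pow_add, ← (Commute.pow_pow_self (H N δ α) 2 (2 * n)).eq, sq, mul_assoc,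
      blocks_mul, blocks_mul, ih, blocks_H_mul_evenBlocks hN, blocks_H_mul_oddBlocks hN,
      ← pow_succ']

lemma blocks_H_pow_odd (hN : 1 ≤ N) (δ α : ℝ) (n : ℕ) :
    blocks (H N δ α ^ (2 * n + 1)) = oddBlocks N δ α (modes N δ α ^ n) := by
  rw [pow_succ', blocks_mul, blocks_H_pow_even hN, blocks_H_mul_evenBlocks hN]

/-! ### The exponential series -/

section Positivity

open scoped ComplexOrder

lemma posSemidef_mode {R : EnvOp N} (hR : R.IsHermitian) (δ α : ℝ) :
    (((δ ^ 2 : ℝ) : ℂ) • (1 : EnvOp N) + ((α ^ 2 / N : ℝ) : ℂ) • R ^ 2).PosSemidef := by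
  have hsq : (R ^ 2).PosSemidef := by
    have h := Matrix.posSemidef_conjTranspose_mul_self R
    rwa [hR.eq, ← sq] at h
  exact (Matrix.PosSemidef.one.smul (Complex.zero_le_real.2 (sq_nonneg δ))).add
    (hsq.smul (Complex.zero_le_real.2 (div_nonneg (sq_nonneg α) (Nat.cast_nonneg N))))

lemma posSemidef_Mplus (δ α : ℝ) (X Y : EnvOp N) : (Mplus δ α X Y).PosSemidef :=
  posSemidef_mode ((opSqrt_posSemidef X).isHermitian.add (opSqrt_posSemidef Y).isHermitian) δ α

lemma posSemidef_Mminus (δ α : ℝ) (X Y : EnvOp N) : (Mminus δ α X Y).PosSemidef :=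
  posSemidef_mode ((opSqrt_posSemidef X).isHermitian.sub (opSqrt_posSemidef Y).isHermitian) δ α

lemma posSemidef_modes (N : ℕ) (δ α : ℝ) (j : Fin 4) (b : Bool) :
    (modes N δ α j b).PosSemidef := by
  fin_cases j <;> cases b
  · exact posSemidef_Mminus _ _ _ _
  · exact posSemidef_Mplus _ _ _ _
  · exact posSemidef_Mminus _ _ _ _
  · exact posSemidef_Mplus _ _ _ _
  · exact posSemidef_Mminus _ _ _ _
  · exact posSemidef_Mplus _ _ _ _
  · exact posSemidef_Mminus _ _ _ _
  · exact posSemidef_Mplus _ _ _ _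

end Positivity

open scoped Matrix.Norms.Operator in
lemma hasSum_exp_smul {m : Type*} [Fintype m] [DecidableEq m] (z : ℂ) (T : Matrix m m ℂ) :
    HasSum (fun n : ℕ => (z ^ n / n.factorial) • T ^ n) (NormedSpace.exp (z • T)) := by
  have h := NormedSpace.exp_series_hasSum_exp' (𝕂 := ℂ) (z • T)
  refine h.congr_fun fun n => ?_
  rw [smul_pow, smul_smul, div_eq_inv_mul]

/-- The entry `T ↦ T_{ij}` as a linear map. -/
def blockEntry (N : ℕ) (i j : Fin 4) : TotalOp N →ₗ[ℂ] EnvOp N where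
  toFun T := blocks T i j
  map_add' _ _ := rfl
  map_smul' _ _ := rfl

lemma hasSum_map_linearMap {E F : Type*} [AddCommGroup E] [Module ℂ E] [TopologicalSpace E]
    [IsTopologicalAddGroup E] [ContinuousSMul ℂ E] [T2Space E] [FiniteDimensional ℂ E]
    [AddCommGroup F] [Module ℂ F] [TopologicalSpace F] [IsTopologicalAddGroup F]
    [ContinuousSMul ℂ F] (L : E →ₗ[ℂ] F) {f : ℕ → E} {a : E} (h : HasSum f a) :
    HasSum (fun n => L (f n)) (L a) :=
  h.map L L.continuous_of_finiteDimensional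

lemma exp_coeff_even (t : ℝ) (n : ℕ) :
    (-(Complex.I * t)) ^ (2 * n) / ((2 * n).factorial : ℂ) =
      (((-1) ^ n * t ^ (2 * n) / (2 * n).factorial : ℝ) : ℂ) := by
  push_cast
  rw [pow_mul, neg_sq, mul_pow, Complex.I_sq, mul_pow, ← pow_mul]

lemma exp_coeff_odd (t : ℝ) (n : ℕ) :
    (-(Complex.I * t)) ^ (2 * n + 1) / ((2 * n + 1).factorial : ℂ) =
      -Complex.I * (((-1) ^ n * t ^ (2 * n + 1) / (2 * n + 1).factorial : ℝ) : ℂ) := by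
  push_cast
  rw [pow_succ, pow_mul, neg_sq, mul_pow, Complex.I_sq, mul_pow, ← pow_mul]
  ring

/-- The even part `cos (t H)` and the odd part `-i sin (t H)` of `exp (-i t H)` are the values of
`evenEntries` and `-i` times `oddEntries` at `cos (t √𝓜_j^±)` and `sin (t √𝓜_j^±) / √𝓜_j^±`. -/
lemma blocks_exp_apply (hN : 1 ≤ N) (δ α t : ℝ) (i j : Fin 4) :
    blocks (NormedSpace.exp ((-(Complex.I * t)) • H N δ α)) i j =
      evenEntries N i j (fun k b => opCos t (modes N δ α k b)) +
        (-Complex.I) • oddEntries N δ α i j (fun k b => opSinDiv t (modes N δ α k b)) := by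
  have hcos : HasSum
      (fun n : ℕ => (((-1) ^ n * t ^ (2 * n) / (2 * n).factorial : ℝ) : ℂ) • modes N δ α ^ n)
      (fun k b => opCos t (modes N δ α k b)) :=
    Pi.hasSum.2 fun k => Pi.hasSum.2 fun b => hasSum_opCos (posSemidef_modes N δ α k b) t
  have hsin : HasSum
      (fun n : ℕ => (((-1) ^ n * t ^ (2 * n + 1) / (2 * n + 1).factorial : ℝ) : ℂ) •
        modes N δ α ^ n)
      (fun k b => opSinDiv t (modes N δ α k b)) :=
    Pi.hasSum.2 fun k => Pi.hasSum.2 fun b => hasSum_opSinDiv (posSemidef_modes N δ α k b) t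
  have hexp := hasSum_map_linearMap (blockEntry N i j)
    (hasSum_exp_smul (-(Complex.I * t)) (H N δ α))
  refine hexp.unique (HasSum.even_add_odd ?_ ?_)
  · refine (hasSum_map_linearMap (evenEntries N i j) hcos).congr_fun fun n => ?_
    rw [map_smul, map_smul, exp_coeff_even]
    exact congrArg _ (congrFun (congrFun (blocks_H_pow_even hN δ α n) i) j)
  · refine ((hasSum_map_linearMap (oddEntries N δ α i j) hsin).const_smul
      (-Complex.I)).congr_fun fun n => ?_
    rw [map_smul, map_smul, exp_coeff_odd, mul_smul]
    exact congrArg _ (congrArg _ (congrFun (congrFun (blocks_H_pow_odd hN δ α n) i) j))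

/-! Collecting the cosine and sine terms of an entry; `p` and `q` are the cosine and sine parts. -/

section Combination

variable {V : Type*} [AddCommGroup V] [Module ℂ V] (δ : ℂ)

lemma half_smul_sub (p q : V) :
    (1 / 2 : ℂ) • p + (-Complex.I) • (δ / 2) • q = (1 / 2 : ℂ) • (p - (Complex.I * δ) • q) := by
  module

lemma half_smul_add (p q : V) :
    (1 / 2 : ℂ) • p + (-Complex.I) • (-(δ / 2)) • q =
      (1 / 2 : ℂ) • (p + (Complex.I * δ) • q) := by
  module

lemma zero_add_smul (q : V) :
    0 + (-Complex.I) • (δ / 2) • q = (-(Complex.I * δ / 2)) • q := by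
  module

lemma half_smul_mul_sub (T p q : EnvOp N) :
    (1 / 2 : ℂ) • (T * p) + (-Complex.I) • (δ / 2) • (T * q) =
      (1 / 2 : ℂ) • (T * (p - (Complex.I * δ) • q)) := by
  rw [half_smul_sub, mul_sub, mul_smul_comm]

lemma half_smul_mul_add (T p q : EnvOp N) :
    (1 / 2 : ℂ) • (T * p) + (-Complex.I) • (-(δ / 2)) • (T * q) =
      (1 / 2 : ℂ) • (T * (p + (Complex.I * δ) • q)) := by
  rw [half_smul_add, mul_add, mul_smul_comm]

end Combination

end SpinStar

open SpinStar in
theorem mainTheorem2 (N : ℕ) (hN : 1 ≤ N) (δ α : ℝ) :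
    (∀ n : ℕ, blocks (H N δ α ^ (2 * n)) = !![
      -- row 1
      (1 / 2 : ℂ) • ((M1p N δ α) ^ n + (M1m N δ α) ^ n),
      0,
      0,
      (1 / 2 : ℂ) • (Jp N * Kp N * opInvSqrt (Jm N * Jp N * Km N * Kp N) * ((M4p N δ α) ^ n - (M4m N δ α) ^ n));
      -- row 2
      0,
      (1 / 2 : ℂ) • ((M2p N δ α) ^ n + (M2m N δ α) ^ n),
      (1 / 2 : ℂ) • (Jp N * Km N * opInvSqrt (Jm N * Jp N * Kp N * Km N) * ((M3p N δ α) ^ n - (M3m N δ α) ^ n)),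
      0;
      -- row 3
      0,
      (1 / 2 : ℂ) • (Jm N * Kp N * opInvSqrt (Jp N * Jm N * Km N * Kp N) * ((M2p N δ α) ^ n - (M2m N δ α) ^ n)),
      (1 / 2 : ℂ) • ((M3p N δ α) ^ n + (M3m N δ α) ^ n),
      0;
      -- row 4
      (1 / 2 : ℂ) • (Jm N * Km N * opInvSqrt (Jp N * Jm N * Kp N * Km N) * ((M1p N δ α) ^ n - (M1m N δ α) ^ n)),
      0,
      0,
      (1 / 2 : ℂ) • ((M4p N δ α) ^ n + (M4m N δ α) ^ n)]) ∧
    (∀ n : ℕ, blocks (H N δ α ^ (2 * n + 1)) = !![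
      -- row 1
      (δ / 2 : ℂ) • ((M1p N δ α) ^ n + (M1m N δ α) ^ n),
      (α / 2 : ℂ) • (Kp N * opInvSqrt ((N : ℂ) • (Km N * Kp N)) *
        ((s₂ N + r₁ N) * (M2p N δ α) ^ n + (s₂ N - r₁ N) * (M2m N δ α) ^ n)),
      (α / 2 : ℂ) • (Jp N * opInvSqrt ((N : ℂ) • (Jm N * Jp N)) *
        ((r₂ N + s₁ N) * (M3p N δ α) ^ n + (r₂ N - s₁ N) * (M3m N δ α) ^ n)),
      (δ / 2 : ℂ) • (Jp N * Kp N * opInvSqrt (Jm N * Jp N * Km N * Kp N) * ((M4p N δ α) ^ n - (M4m N δ α) ^ n));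
      -- row 2
      (α / 2 : ℂ) • (Km N * opInvSqrt ((N : ℂ) • (Kp N * Km N)) *
        ((s₁ N + r₁ N) * (M1p N δ α) ^ n + (s₁ N - r₁ N) * (M1m N δ α) ^ n)),
      (-(δ / 2) : ℂ) • ((M2p N δ α) ^ n + (M2m N δ α) ^ n),
      (-(δ / 2) : ℂ) • (Jp N * Km N * opInvSqrt (Jm N * Jp N * Kp N * Km N) * ((M3p N δ α) ^ n - (M3m N δ α) ^ n)),
      (α / 2 : ℂ) • (Jp N * opInvSqrt ((N : ℂ) • (Jm N * Jp N)) *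
        ((r₂ N + s₂ N) * (M4p N δ α) ^ n + (r₂ N - s₂ N) * (M4m N δ α) ^ n));
      -- row 3
      (α / 2 : ℂ) • (Jm N * opInvSqrt ((N : ℂ) • (Jp N * Jm N)) *
        ((r₁ N + s₁ N) * (M1p N δ α) ^ n + (r₁ N - s₁ N) * (M1m N δ α) ^ n)),
      (-(δ / 2) : ℂ) • (Jm N * Kp N * opInvSqrt (Jp N * Jm N * Km N * Kp N) * ((M2p N δ α) ^ n - (M2m N δ α) ^ n)),
      (-(δ / 2) : ℂ) • ((M3p N δ α) ^ n + (M3m N δ α) ^ n),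
      (α / 2 : ℂ) • (Kp N * opInvSqrt ((N : ℂ) • (Km N * Kp N)) *
        ((s₂ N + r₂ N) * (M4p N δ α) ^ n + (s₂ N - r₂ N) * (M4m N δ α) ^ n));
      -- row 4
      (δ / 2 : ℂ) • (Jm N * Km N * opInvSqrt (Jp N * Jm N * Kp N * Km N) * ((M1p N δ α) ^ n - (M1m N δ α) ^ n)),
      (α / 2 : ℂ) • (Jm N * opInvSqrt ((N : ℂ) • (Jp N * Jm N)) *
        ((r₁ N + s₂ N) * (M2p N δ α) ^ n + (r₁ N - s₂ N) * (M2m N δ α) ^ n)),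
      (α / 2 : ℂ) • (Km N * opInvSqrt ((N : ℂ) • (Kp N * Km N)) *
        ((s₁ N + r₂ N) * (M3p N δ α) ^ n + (s₁ N - r₂ N) * (M3m N δ α) ^ n)),
      (δ / 2 : ℂ) • ((M4p N δ α) ^ n + (M4m N δ α) ^ n)]) ∧
    (∀ t : ℝ, blocks (NormedSpace.exp ((-(Complex.I * t)) • H N δ α)) = !![
      -- row 1
      (1 / 2 : ℂ) • (opCos t (M1p N δ α) + opCos t (M1m N δ α)
        - (Complex.I * δ) • (opSinDiv t (M1p N δ α) + opSinDiv t (M1m N δ α))),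
      (-(Complex.I * α / 2)) • (Kp N * opInvSqrt ((N : ℂ) • (Km N * Kp N)) *
        ((s₂ N + r₁ N) * opSinDiv t (M2p N δ α) + (s₂ N - r₁ N) * opSinDiv t (M2m N δ α))),
      (-(Complex.I * α / 2)) • (Jp N * opInvSqrt ((N : ℂ) • (Jm N * Jp N)) *
        ((r₂ N + s₁ N) * opSinDiv t (M3p N δ α) + (r₂ N - s₁ N) * opSinDiv t (M3m N δ α))),
      (1 / 2 : ℂ) • (Jp N * Kp N * opInvSqrt (Jm N * Jp N * Km N * Kp N) * (opCos t (M4p N δ α) - opCos t (M4m N δ α)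
        - (Complex.I * δ) • (opSinDiv t (M4p N δ α) - opSinDiv t (M4m N δ α))));
      -- row 2
      (-(Complex.I * α / 2)) • (Km N * opInvSqrt ((N : ℂ) • (Kp N * Km N)) *
        ((s₁ N + r₁ N) * opSinDiv t (M1p N δ α) + (s₁ N - r₁ N) * opSinDiv t (M1m N δ α))),
      (1 / 2 : ℂ) • (opCos t (M2p N δ α) + opCos t (M2m N δ α)
        + (Complex.I * δ) • (opSinDiv t (M2p N δ α) + opSinDiv t (M2m N δ α))),
      (1 / 2 : ℂ) • (Jp N * Km N * opInvSqrt (Jm N * Jp N * Kp N * Km N) * (opCos t (M3p N δ α) - opCos t (M3m N δ α)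
        + (Complex.I * δ) • (opSinDiv t (M3p N δ α) - opSinDiv t (M3m N δ α)))),
      (-(Complex.I * α / 2)) • (Jp N * opInvSqrt ((N : ℂ) • (Jm N * Jp N)) *
        ((r₂ N + s₂ N) * opSinDiv t (M4p N δ α) + (r₂ N - s₂ N) * opSinDiv t (M4m N δ α)));
      -- row 3
      (-(Complex.I * α / 2)) • (Jm N * opInvSqrt ((N : ℂ) • (Jp N * Jm N)) *
        ((r₁ N + s₁ N) * opSinDiv t (M1p N δ α) + (r₁ N - s₁ N) * opSinDiv t (M1m N δ α))),
      (1 / 2 : ℂ) • (Jm N * Kp N * opInvSqrt (Jp N * Jm N * Km N * Kp N) * (opCos t (M2p N δ α) - opCos t (M2m N δ α)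
        + (Complex.I * δ) • (opSinDiv t (M2p N δ α) - opSinDiv t (M2m N δ α)))),
      (1 / 2 : ℂ) • (opCos t (M3p N δ α) + opCos t (M3m N δ α)
        + (Complex.I * δ) • (opSinDiv t (M3p N δ α) + opSinDiv t (M3m N δ α))),
      (-(Complex.I * α / 2)) • (Kp N * opInvSqrt ((N : ℂ) • (Km N * Kp N)) *
        ((s₂ N + r₂ N) * opSinDiv t (M4p N δ α) + (s₂ N - r₂ N) * opSinDiv t (M4m N δ α)));
      -- row 4
      (1 / 2 : ℂ) • (Jm N * Km N * opInvSqrt (Jp N * Jm N * Kp N * Km N) * (opCos t (M1p N δ α) - opCos t (M1m N δ α)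
        - (Complex.I * δ) • (opSinDiv t (M1p N δ α) - opSinDiv t (M1m N δ α)))),
      (-(Complex.I * α / 2)) • (Jm N * opInvSqrt ((N : ℂ) • (Jp N * Jm N)) *
        ((r₁ N + s₂ N) * opSinDiv t (M2p N δ α) + (r₁ N - s₂ N) * opSinDiv t (M2m N δ α))),
      (-(Complex.I * α / 2)) • (Km N * opInvSqrt ((N : ℂ) • (Kp N * Km N)) *
        ((s₁ N + r₂ N) * opSinDiv t (M3p N δ α) + (s₁ N - r₂ N) * opSinDiv t (M3m N δ α))),
      (1 / 2 : ℂ) • (opCos t (M4p N δ α) + opCos t (M4m N δ α)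
        - (Complex.I * δ) • (opSinDiv t (M4p N δ α) + opSinDiv t (M4m N δ α)))]) := by
  refine ⟨fun n => ?_, fun n => ?_, fun t => ?_⟩
  · rw [blocks_H_pow_even hN]
    ext1 i j
    fin_cases i <;> fin_cases j <;> rfl
  · rw [blocks_H_pow_odd hN]
    ext1 i j
    fin_cases i <;> fin_cases j <;> rfl
  · ext1 i j
    rw [blocks_exp_apply hN]
    fin_cases i <;> fin_cases j
    · exact half_smul_sub _ _ _
    · exact zero_add_smul _ _
    · exact zero_add_smul _ _
    · exact half_smul_mul_sub _ _ _ _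
    · exact zero_add_smul _ _
    · exact half_smul_add _ _ _
    · exact half_smul_mul_add _ _ _ _
    · exact zero_add_smul _ _
    · exact zero_add_smul _ _
    · exact half_smul_mul_add _ _ _ _
    · exact half_smul_add _ _ _
    · exact zero_add_smul _ _
    · exact half_smul_mul_sub _ _ _ _
    · exact zero_add_smul _ _
    · exact zero_add_smul _ _
    · exact half_smul_sub _ _ _
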